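/- Let $\mathbb F$ be an algebraically closed field of characteristic $0$ and let $\mathfrak g$ be a finite-dimensional simple Lie algebra over $\mathbb F$. Definitions. On an affine space $\mathfrak a$ over $\mathbb F$ put $\langle a,b,c\rangle = a-b+c$ (the point $c$ translated by the vector from $b$ to $a$). For $o\in\mathfrak a$ the tangent space $T_o\mathfrak a$ is the set $\mathfrak a$ with the vector space structure that has zero $o$, addition $a+b=\langle a,o,b\rangle$ and scalar multiplication $\alpha a=$ the point $(1-\alpha)o+\alpha a$ of the line through $o$ and $a$. Let $\{-,-\}\colon\mathfrak a\times\mathfrak a\to\mathfrak a$ be a bi-affine map. Its Leibnizian is $$\Lambda(a,b,c)=\big\langle \{a,\{b,c\}\},\ \{\{a,b\},c\},\ \{\{a,c\},b\}\big\rangle .$$ The bracket is an affine Leibniz bracket, and $(\mathfrak a,\{-,-\})$ a Leibniz affgebra, if for some point $o$ the linearization of $\Lambda$ vanishes, i.e. in $T_o\mathfrak a$ $$\Lambda(a,b,c)-\Lambda(a,b,o)-\Lambda(a,o,c)-\Lambda(o,b,c)+\Lambda(a,o,o)+\Lambda(o,b,o)+\Lambda(o,o,c)-\Lambda(o,o,o)=o$$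 for all $a,b,c\in\mathfrak a$. It is homogeneous if moreover $\Lambda(a,b,c)=\{a,\{b,b\}\}$ for all $a,b,c\in\mathfrak a$. The fibre at $o$ is $T_o\mathfrak a$ with the bracket $[a,b]=\{a,b\}-\{a,o\}+\{o,o\}-\{o,b\}$. An isomorphism of Leibniz affgebras is an affine isomorphism that preserves the brackets. For linear maps $\lambda,\mu\colon\mathfrak g\to\mathfrak g$ and $s\in\mathfrak g$, $\mathfrak a(\mathfrak g;\lambda,\mu,s)$ denotes the affine space $\mathfrak g$ with the bracket $\{a,b\}=[a,b]+\lambda(a)+\mu(b)+s$. Theorem. Let $(\mathfrak a,\{-,-\})$ be a homogeneous Leibniz affgebra over $\mathbb F$ whose fibre at some point is isomorphic, as an algebra, to $\mathfrak g$. Then there is $\alpha\in\mathbb F$ such that $\mathfrak a(\mathfrak g;\alpha\,\mathrm{id},0,0)$ is a Leibniz affgebra and $(\mathfrak a,\{-,-\})$ is isomorphic to it. -/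

import Mathlib

namespace Affgebra

section AffineSpace

variable {V P : Type*} [AddCommGroup V] [AddTorsor V P]

/-- The heap operation of an affine space, `⟨a, b, c⟩ = a - b + c`: the point `c` translated by the
vector from `b` to `a`. -/
def heap (a b c : P) : P := (a -ᵥ b) +ᵥ c

/-- The tangent space (fibre) of an affine space `P` at a point `o`. Its underlying set is `P`
itself, its zero is `o`, its addition is `a + b = ⟨a, o, b⟩`, and `α • a` is the point
`(1 - α) o + α a` of the line through `o` and `a`. -/
def Tangent (_o : P) : Type _ := P

/-- The identity map, regarding a point of `P` as an element of the tangent space at `o`. -/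
def toTangent (o : P) : P ≃ Tangent o := Equiv.refl P

/-- The bijection of the tangent space at `o` with the space of translations, sending `a` to the
vector from `o` to `a`; the vector space structure of the tangent space is transported along it. -/
def tangentEquiv (o : P) : Tangent o ≃ V := (toTangent o).symm.trans (Equiv.vaddConst o).symm

noncomputable instance (o : P) : AddCommGroup (Tangent o) := (tangentEquiv o).addCommGroup

noncomputable instance (F : Type*) [Field F] [Module F V] (o : P) : Module F (Tangent o) :=
  (tangentEquiv o).module F

theorem tangent_zero (o : P) : (0 : Tangent o) = toTangent o o :=
  (tangentEquiv o).injective (by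
    rw [Equiv.zero_def, Equiv.apply_symm_apply]
    exact (vsub_self o).symm)

theorem tangent_add (o a b : P) : toTangent o a + toTangent o b = toTangent o (heap a o b) :=
  (tangentEquiv o).injective (by
    rw [Equiv.add_def, Equiv.apply_symm_apply]
    exact (vadd_vsub_assoc (a -ᵥ o) b o).symm)

theorem tangent_smul {F : Type*} [Field F] [Module F V] (o a : P) (α : F) :
    α • toTangent o a = toTangent o (AffineMap.lineMap o a α) :=
  (tangentEquiv o).injective (by
    rw [Equiv.smul_def, Equiv.apply_symm_apply]
    exact (AffineMap.lineMap_vsub_left o a α).symm)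

/-- A binary operation on an affine space that is an affine map in each argument separately. -/
def IsBiaffine (F : Type*) [Field F] [Module F V] (br : P → P → P) : Prop :=
  (∀ b, ∃ f : P →ᵃ[F] P, ∀ a, f a = br a b) ∧ (∀ a, ∃ f : P →ᵃ[F] P, ∀ b, f b = br a b)

/-- The Leibnizian `Λ(a, b, c) = ⟨{a, {b, c}}, {{a, b}, c}, {{a, c}, b}⟩` of a bracket. -/
def leibnizian (br : P → P → P) (a b c : P) : P :=
  heap (br a (br b c)) (br (br a b) c) (br (br a c) b)

/-- The linearization of a ternary operation at the point `o`, computed in the tangent space. -/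
noncomputable def linearization₃ (Λ : P → P → P → P) (o a b c : P) : Tangent o :=
  toTangent o (Λ a b c) - toTangent o (Λ a b o) - toTangent o (Λ a o c) - toTangent o (Λ o b c)
    + toTangent o (Λ a o o) + toTangent o (Λ o b o) + toTangent o (Λ o o c) - toTangent o (Λ o o o)

/-- Affine Leibniz brackets: bi-affine operations whose Leibnizian has vanishing linearization at
some point. An affine space with such an operation is a Leibniz affgebra. -/
def IsAffineLeibniz (F : Type*) [Field F] [Module F V] (br : P → P → P) : Prop :=
  IsBiaffine F br ∧ ∃ o : P, ∀ a b c : P, linearization₃ (leibnizian br) o a b c = 0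

/-- Homogeneous affine Leibniz brackets: the Leibnizian is `Λ(a, b, c) = {a, {b, b}}`. -/
def IsHomogeneousLeibniz (F : Type*) [Field F] [Module F V] (br : P → P → P) : Prop :=
  IsAffineLeibniz F br ∧ ∀ a b c : P, leibnizian br a b c = br a (br b b)

/-- The bracket of the fibre at `o`, namely the linearization
`[a, b] = {a, b} - {a, o} + {o, o} - {o, b}` computed in the tangent space at `o`. -/
noncomputable def fibreBracket (br : P → P → P) (o : P) (a b : Tangent o) : Tangent o :=
  let p := (toTangent o).symm a
  let q := (toTangent o).symm b
  toTangent o (br p q) - toTangent o (br p o) + toTangent o (br o o) - toTangent o (br o q)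

/-- The fibre of `(P, br)` at `o` is isomorphic, as an algebra, to the Lie algebra `𝔤`. -/
def FibreIsoLie (F : Type*) [Field F] [Module F V] (br : P → P → P) (o : P)
    (𝔤 : Type*) [LieRing 𝔤] [LieAlgebra F 𝔤] : Prop :=
  ∃ e : Tangent o ≃ₗ[F] 𝔤, ∀ a b : Tangent o, e (fibreBracket br o a b) = ⁅e a, e b⁆

/-- Isomorphism of affine spaces with brackets: an affine isomorphism that preserves the
brackets. -/
def IsoAffgebra (F : Type*) [Field F] [Module F V] {W Q : Type*} [AddCommGroup W] [Module F W]
    [AddTorsor W Q] (br : P → P → P) (br' : Q → Q → Q) : Prop :=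
  ∃ φ : P ≃ᵃ[F] Q, ∀ a b : P, φ (br a b) = br' (φ a) (φ b)

end AffineSpace

/-- The bracket `{a, b} = [a, b] + lam a + mu b + s` of `𝔞(𝔤; lam, mu, s)`, on the vector space `𝔤`
viewed as an affine space. -/
def extBracket {F 𝔤 : Type*} [Field F] [LieRing 𝔤] [LieAlgebra F 𝔤]
    (lam mu : 𝔤 →ₗ[F] 𝔤) (s : 𝔤) (a b : 𝔤) : 𝔤 :=
  ⁅a, b⁆ + lam a + mu b + s

end Affgebra

/-!
At a point `o` whose fibre is `𝔤`, a bi-affine bracket reads `{a, b} = [a, b] + λ a + μ b + s`, with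
`λ` and `μ` linear. Comparing the components of `Λ(a, b, c) = {a, {b, b}}` of each multidegree in
`a, b, c` leaves three conditions (`homogeneous_mu_lie`, `homogeneous_lam_lie`,
`homogeneous_mu_mu`):

* `μ [b, c] = [μ b, c] + [b, μ c]`,
* `λ [a, b] = [λ a, b] - [a, μ b]`,
* `μ² b + λ μ b = μ b + [s, b]`.

By Cartan's criterion the Killing form of `𝔤` is nondegenerate, so the derivation `μ` is inner, say
`μ = ad d`. The first two conditions put `λ + μ` in the centroid of `𝔤`, so `λ + μ = α id` by Schur's
lemma (`exists_eq_smul_of_map_lie`). The third one then reads `(α - 1) ad d = ad s`, and `𝔤` has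
trivial centre, so `s = (α - 1) d`. Substituting gives `{a, b} + d = [a + d, b + d] + α (a + d)`: the
translation by `d` is an isomorphism onto `𝔞(𝔤; α id, 0, 0)`.
-/

namespace Affgebra

section LieAlgebra

variable {F 𝔤 : Type*} [Field F] [LieRing 𝔤] [LieAlgebra F 𝔤]

section Homogeneous

variable {lam mu : 𝔤 →ₗ[F] 𝔤} {s : 𝔤}

theorem homogeneous_mu_mu
    (h : ∀ a b c, leibnizian (extBracket lam mu s) a b c =
      extBracket lam mu s a (extBracket lam mu s b b)) (b : 𝔤) :
    mu (mu b) + lam (mu b) = mu b + ⁅s, b⁆ := by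
  have h1 := h 0 b 0
  simp only [leibnizian, heap, extBracket, vsub_eq_sub, vadd_eq_add, map_add, map_zero, zero_lie,
    lie_zero, lie_self, add_lie, lie_add] at h1
  linear_combination (norm := module) -h1

theorem homogeneous_mu_lie
    (h : ∀ a b c, leibnizian (extBracket lam mu s) a b c =
      extBracket lam mu s a (extBracket lam mu s b b)) (b c : 𝔤) :
    mu ⁅b, c⁆ = ⁅b, mu c⁆ - ⁅c, mu b⁆ := by
  have h1 := h 0 b c
  have h2 := homogeneous_mu_mu h c
  simp only [leibnizian, heap, extBracket, vsub_eq_sub, vadd_eq_add, map_add, map_zero, zero_lie,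
    lie_self, add_lie, lie_add] at h1
  have h3 := homogeneous_mu_mu h b
  rw [← lie_skew b (mu c), ← lie_skew c (mu b)]
  linear_combination (norm := module) h1 - h2 + h3

theorem homogeneous_lam_lie
    (h : ∀ a b c, leibnizian (extBracket lam mu s) a b c =
      extBracket lam mu s a (extBracket lam mu s b b)) (a c : 𝔤) :
    lam ⁅a, c⁆ = ⁅lam a, c⁆ - ⁅a, mu c⁆ := by
  have h1 := h a 0 c
  have h2 := homogeneous_mu_mu h c
  simp only [leibnizian, heap, extBracket, vsub_eq_sub, vadd_eq_add, map_add, map_zero, zero_lie,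
    lie_zero, lie_self, add_lie, lie_add] at h1
  linear_combination (norm := module) h1 - h2

end Homogeneous

/-- The centroid of a simple Lie algebra over an algebraically closed field consists of scalars:
an eigenspace of a map commuting with right multiplications is an ideal. -/
theorem exists_eq_smul_of_map_lie [IsAlgClosed F] [FiniteDimensional F 𝔤]
    [LieAlgebra.IsSimple F 𝔤] (f : 𝔤 →ₗ[F] 𝔤) (hf : ∀ a b, f ⁅a, b⁆ = ⁅f a, b⁆) :
    ∃ α : F, ∀ a, f a = α • a := by
  have := LieAlgebra.IsSimple.nontrivial F 𝔤
  obtain ⟨α, hα⟩ := Module.End.exists_eigenvalue f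
  let I : LieIdeal F 𝔤 :=
    { Module.End.eigenspace f α with
      lie_mem := by
        intro x m hm
        replace hm : f m = α • m := Module.End.mem_eigenspace_iff.mp hm
        refine Module.End.mem_eigenspace_iff.mpr ?_
        rw [← lie_skew, map_neg, hf, hm, smul_lie, smul_neg] }
  have hI : I = ⊤ := (LieAlgebra.IsSimple.eq_bot_or_eq_top I).resolve_left fun h ↦ hα (by
    rw [← LieSubmodule.toSubmodule_eq_bot] at h
    exact h)
  refine ⟨α, fun a ↦ ?_⟩
  have ha : a ∈ I := hI ▸ LieSubmodule.mem_top a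
  exact Module.End.mem_eigenspace_iff.mp ha

/-- Derivations of a finite-dimensional simple Lie algebra in characteristic zero are inner. -/
theorem exists_eq_lie_of_derivation [CharZero F] [FiniteDimensional F 𝔤]
    [LieAlgebra.IsSimple F 𝔤] (f : 𝔤 →ₗ[F] 𝔤) (hf : ∀ a b, f ⁅a, b⁆ = ⁅a, f b⁆ - ⁅b, f a⁆) :
    ∃ d : 𝔤, ∀ a, f a = ⁅d, a⁆ := by
  obtain ⟨d, hd⟩ := LieDerivation.IsKilling.exists_eq_ad (⟨f, hf⟩ : LieDerivation F 𝔤 𝔤)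
  refine ⟨d, fun a ↦ ?_⟩
  rw [← LieDerivation.ad_apply_apply F, hd]
  rfl

/-- A homogeneous bracket on `𝔤` is conjugate by a translation to some `𝔞(𝔤; α id, 0, 0)`. -/
theorem exists_translation_extBracket [IsAlgClosed F] [CharZero F] [FiniteDimensional F 𝔤]
    [LieAlgebra.IsSimple F 𝔤] {lam mu : 𝔤 →ₗ[F] 𝔤} {s : 𝔤}
    (h : ∀ a b c, leibnizian (extBracket lam mu s) a b c =
      extBracket lam mu s a (extBracket lam mu s b b)) :
    ∃ (α : F) (d : 𝔤), ∀ a b, d + extBracket lam mu s a b =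
      extBracket (α • (LinearMap.id : 𝔤 →ₗ[F] 𝔤)) 0 0 (d + a) (d + b) := by
  obtain ⟨d, hd⟩ := exists_eq_lie_of_derivation mu (homogeneous_mu_lie h)
  obtain ⟨α, hα⟩ := exists_eq_smul_of_map_lie (lam + mu) fun a b ↦ by
    rw [LinearMap.add_apply, LinearMap.add_apply, homogeneous_lam_lie h, homogeneous_mu_lie h,
      add_lie, ← lie_skew b (mu a)]
    abel
  have hlam (a : 𝔤) : lam a = α • a - ⁅d, a⁆ := by
    rw [← hα, LinearMap.add_apply, hd, add_sub_cancel_right]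
  have hs : s = (α - 1) • d := by
    rw [← sub_eq_zero, ← LieSubmodule.mem_bot (R := F) (L := 𝔤),
      ← LieAlgebra.center_eq_bot F 𝔤, LieModule.mem_maxTrivSubmodule]
    intro x
    have hx := homogeneous_mu_mu h x
    rw [hlam, hd, hd] at hx
    rw [← lie_skew, sub_lie, smul_lie, sub_smul, one_smul, neg_eq_zero, sub_eq_zero]
    linear_combination (norm := module) -hx
  refine ⟨α, d, fun a b ↦ ?_⟩
  simp only [extBracket, hlam, hd, hs, LinearMap.smul_apply, LinearMap.id_apply,
    LinearMap.zero_apply, add_lie, lie_add, lie_self, smul_add, sub_smul, one_smul]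
  rw [← lie_skew a d]
  abel

theorem isBiaffine_extBracket (lam mu : 𝔤 →ₗ[F] 𝔤) (s : 𝔤) :
    IsBiaffine F (extBracket lam mu s) := by
  refine ⟨fun b ↦ ⟨(-(LieAlgebra.ad F 𝔤 b : 𝔤 →ₗ[F] 𝔤) + lam).toAffineMap +
    AffineMap.const F 𝔤 (mu b + s), fun a ↦ ?_⟩,
    fun a ↦ ⟨((LieAlgebra.ad F 𝔤 a : 𝔤 →ₗ[F] 𝔤) + mu).toAffineMap +
    AffineMap.const F 𝔤 (lam a + s), fun b ↦ ?_⟩⟩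
  · simp [extBracket, add_assoc]
  · simp [extBracket]
    abel

theorem isAffineLeibniz_extBracket_smul_id (α : F) :
    IsAffineLeibniz F (extBracket (α • (LinearMap.id : 𝔤 →ₗ[F] 𝔤)) 0 0) := by
  refine ⟨isBiaffine_extBracket _ _ _, 0, fun a b c ↦ (tangentEquiv (0 : 𝔤)).injective ?_⟩
  have key : leibnizian (extBracket (α • (LinearMap.id : 𝔤 →ₗ[F] 𝔤)) 0 0) =
      fun a b _ ↦ α • ⁅a, b⁆ + α • a := by
    funext a b c
    simp only [leibnizian, heap, extBracket, LinearMap.smul_apply, LinearMap.id_apply,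
      LinearMap.zero_apply, vsub_eq_sub, vadd_eq_add, add_zero, add_lie, lie_add, smul_lie, lie_smul,
      smul_add, leibniz_lie a b c]
    rw [← lie_skew b ⁅a, c⁆]
    abel
  congr 1
  simp only [linearization₃, key, lie_zero, zero_lie, smul_zero, zero_add, ← tangent_zero]
  abel

end LieAlgebra

section AffineSpace

variable {F : Type*} [Field F] {V P : Type*} [AddCommGroup V] [Module F V] [AddTorsor V P]

/-- `tangentEquiv` as a linear equivalence. -/
noncomputable def tangentLinearEquiv (F : Type*) [Field F] [Module F V] (o : P) :
    Tangent o ≃ₗ[F] V :=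
  (tangentEquiv o).linearEquiv F

/-- The identity map, as an affine equivalence of `P` with its tangent space at `o`. -/
noncomputable def toTangentAffine (F : Type*) [Field F] [Module F V] (o : P) :
    P ≃ᵃ[F] Tangent o :=
  (AffineEquiv.vaddConst F o).symm.trans (tangentLinearEquiv F o).symm.toAffineEquiv

theorem toTangentAffine_apply (o p : P) : toTangentAffine F o p = toTangent o p :=
  (tangentEquiv o).injective ((tangentEquiv o).apply_symm_apply _)

/-- An affine chart identifies a bi-affine bracket one of whose fibres is `𝔤` with a bracket
`𝔞(𝔤; lam, mu, s)`. -/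
theorem exists_chart_extBracket {𝔤 : Type*} [LieRing 𝔤] [LieAlgebra F 𝔤] {br : P → P → P}
    (hbr : IsBiaffine F br) {o : P} (hfib : FibreIsoLie F br o 𝔤) :
    ∃ (ψ : P ≃ᵃ[F] 𝔤) (lam mu : 𝔤 →ₗ[F] 𝔤) (s : 𝔤),
      ∀ p q, ψ (br p q) = extBracket lam mu s (ψ p) (ψ q) := by
  obtain ⟨e, he⟩ := hfib
  obtain ⟨f, hf⟩ := hbr.1 o
  obtain ⟨g, hg⟩ := hbr.2 o
  let ψ : P ≃ᵃ[F] 𝔤 := (toTangentAffine F o).trans e.toAffineEquiv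
  have hψ (p : P) : ψ p = e (toTangent o p) := congrArg e (toTangentAffine_apply o p)
  have hψo : ψ o = 0 := by rw [hψ, ← tangent_zero, map_zero]
  -- The linear part of an affine self-map of `P`, read in the chart `ψ`, which maps `o` to `0`.
  have aux (k : P →ᵃ[F] P) :
      ∃ l : 𝔤 →ₗ[F] 𝔤, ∀ p, ψ (k p) = l (ψ p) + ψ (k o) := by
    let K : 𝔤 →ᵃ[F] 𝔤 := (ψ : P →ᵃ[F] 𝔤).comp (k.comp (ψ.symm : 𝔤 →ᵃ[F] P))
    have hK (p : P) : K (ψ p) = ψ (k p) := by simp [K]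
    refine ⟨K.linear, fun p ↦ ?_⟩
    have := K.map_vadd (ψ o) (ψ p)
    rw [hψo, vadd_eq_add, add_zero, vadd_eq_add, ← hψo, hK, hK] at this
    exact this
  obtain ⟨lam, hlam⟩ := aux f
  obtain ⟨mu, hmu⟩ := aux g
  refine ⟨ψ, lam, mu, ψ (br o o), fun p q ↦ ?_⟩
  have h1 := he (toTangent o p) (toTangent o q)
  simp only [fibreBracket, Equiv.symm_apply_apply, map_sub, map_add, ← hψ] at h1
  have h2 := hlam p
  have h3 := hmu q
  rw [hf, hf] at h2
  rw [hg, hg] at h3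
  rw [extBracket, ← h1, h2, h3]
  abel

end AffineSpace

end Affgebra

theorem mainTheorem5 {F : Type*} [Field F] [IsAlgClosed F] [CharZero F]
    {𝔤 : Type*} [LieRing 𝔤] [LieAlgebra F 𝔤] [FiniteDimensional F 𝔤] [LieAlgebra.IsSimple F 𝔤]
    {V P : Type*} [AddCommGroup V] [Module F V] [AddTorsor V P]
    (br : P → P → P) (hbr : Affgebra.IsHomogeneousLeibniz F br)
    (hfib : ∃ o : P, Affgebra.FibreIsoLie F br o 𝔤) :
    ∃ α : F,
      Affgebra.IsAffineLeibniz F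
        (Affgebra.extBracket (α • (LinearMap.id : 𝔤 →ₗ[F] 𝔤)) 0 0) ∧
      Affgebra.IsoAffgebra F br
        (Affgebra.extBracket (α • (LinearMap.id : 𝔤 →ₗ[F] 𝔤)) 0 0) := by
  obtain ⟨o, ho⟩ := hfib
  obtain ⟨ψ, lam, mu, s, hψ⟩ := Affgebra.exists_chart_extBracket hbr.1.1 ho
  have hheap (p q r : P) :
      ψ (Affgebra.heap p q r) = Affgebra.heap (ψ p) (ψ q) (ψ r) := by
    simp only [Affgebra.heap, AffineEquiv.map_vadd]
    congr 1
    exact (ψ : P →ᵃ[F] 𝔤).linearMap_vsub p q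
  obtain ⟨α, d, hd⟩ := Affgebra.exists_translation_extBracket (lam := lam) (mu := mu) (s := s)
    fun a b c ↦ by
      obtain ⟨p, rfl⟩ := ψ.surjective a
      obtain ⟨q, rfl⟩ := ψ.surjective b
      obtain ⟨r, rfl⟩ := ψ.surjective c
      have h := congrArg ψ (hbr.2 p q r)
      simp only [Affgebra.leibnizian, hheap, hψ] at h
      exact h
  refine ⟨α, Affgebra.isAffineLeibniz_extBracket_smul_id α,
    ψ.trans (AffineEquiv.constVAdd F 𝔤 d), fun a b ↦ ?_⟩
  simp only [AffineEquiv.trans_apply, AffineEquiv.constVAdd_apply, vadd_eq_add, hψ, hd]
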